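/- Every rational $x\in[0,1]$ has a unique finite odd continued fraction $$x=1+\cfrac{\varepsilon_1}{a_1+\cfrac{\varepsilon_2}{a_2+\cdots+\cfrac{\varepsilon_l}{a_l}}},\qquad l\ge 0,$$ with $a_j$ odd positive integers, $\varepsilon_j=\pm1$, $\varepsilon_1=-1$, $a_j+\varepsilon_{j+1}\ge 2$ for $1\le j<l$, and, if $l\ge2$ and $a_l=1$, $\varepsilon_l=1$. Let $S(x)=a_1+\cdots+a_l$, let $\mathcal M_n=\{x\in\mathbb Q\cap[0,1]: S(x)\le n+1\}$, and let $$F(x)=\lim_{n\to\infty}\frac{\#\{\xi\in\mathcal M_n:\xi\le x\}}{\#\mathcal M_n},\qquad x\in[0,1],$$ be the limit distribution function of the sequence $\mathcal M_n$. Let $\lambda$ be the unique real root of $\lambda^3-\lambda^2-\lambda-1=0$. Then the limit $F(x)$ exists for every $x\in[0,1]$, and for every integer $n\ge1$ and every $x\in[0,1]$, $$\frac{1-F(1-x)}{\lambda^{2n-1}}=\frac1{\lambda^{2n-2}}-1+F\left(1-\frac1{2n-1+x}\right),$$ $$\frac{1-F(1-x)}{\lambda^{2n}}=1-F\left(1-\frac{1}{2n+\frac1x}\right),$$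 where in the second equation $\frac{1}{2n+1/x}$ is read as $0$ for $x=0$. -/

import Mathlib

open Filter Topology

/-- The value of the fraction `ε₁ / (a₁ + ε₂ / (a₂ + ⋯ + ε_l / a_l))` attached to the list
`[(ε₁, a₁), …, (ε_l, a_l)]`; the empty list has value `0`. -/
def oddTail : List (ℤ × ℕ) → ℚ
  | [] => 0
  | (e, a) :: t => (e : ℚ) / ((a : ℚ) + oddTail t)

/-- The list `[(ε₁, a₁), …, (ε_l, a_l)]` is admissible for the finite odd continued fraction
`[1; ε₁/a₁, …, ε_l/a_l]`: the signs are `±1`, the `a_j` are odd, `ε₁ = -1`,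
`a_j + ε_{j+1} ≥ 2`, and a last partial quotient `1` carries the sign `+1`.
The last condition only serves to make representations unique. It is not imposed when `l = 1`,
where the sign is forced to be `-1`: the number `0 = 1 - 1/1` has no other representation. -/
structure IsOddCF (c : List (ℤ × ℕ)) : Prop where
  sign : ∀ p ∈ c, p.1 = 1 ∨ p.1 = -1
  odd : ∀ p ∈ c, Odd p.2
  first : ∀ p ∈ c.head?, p.1 = -1
  step : c.IsChain (fun p q => 2 ≤ (p.2 : ℤ) + q.1)
  last : 2 ≤ c.length → ∀ p ∈ c.getLast?, p.2 = 1 → p.1 = 1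

/-- `c` is the odd continued fraction representation `x = [1; ε₁/a₁, …, ε_l/a_l]`
of the rational number `x`. -/
def RepresentsOdd (c : List (ℤ × ℕ)) (x : ℚ) : Prop :=
  IsOddCF c ∧ 1 + oddTail c = x

/-- The sum `a₁ + ⋯ + a_l` of the partial quotients. -/
def quotientSum (c : List (ℤ × ℕ)) : ℕ := (c.map Prod.snd).sum

/-- `ℳ_n`: the rationals in `[0, 1]` whose odd continued fraction has sum of partial quotients
at most `n + 1`. -/
def oddM (n : ℕ) : Set ℚ :=
  {x | x ∈ Set.Icc (0 : ℚ) 1 ∧ ∃ c, RepresentsOdd c x ∧ quotientSum c ≤ n + 1}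

/-- `F_n(x) = #{ξ ∈ ℳ_n : ξ ≤ x} / #ℳ_n`. -/
noncomputable def oddFn (n : ℕ) (x : ℝ) : ℝ :=
  ({ξ : ℚ | ξ ∈ oddM n ∧ (ξ : ℝ) ≤ x}.ncard : ℝ) / ((oddM n).ncard : ℝ)

/-- The limit distribution function `F(x) = lim F_n(x)` of the sequence `ℳ_n`. -/
noncomputable def oddF (x : ℝ) : ℝ := limUnder atTop (fun n : ℕ => oddFn n x)

theorem existsUnique_tribonacci_root :
    ∃! t : ℝ, t ^ 3 - t ^ 2 - t - 1 = 0 := by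
  have hc : ContinuousOn (fun t : ℝ => t ^ 3 - t ^ 2 - t - 1) (Set.Icc 1 2) := by fun_prop
  obtain ⟨t, ht, h0⟩ := intermediate_value_Icc (by norm_num : (1 : ℝ) ≤ 2) hc
    (show (0 : ℝ) ∈ Set.Icc _ _ by constructor <;> norm_num)
  have h0' : t ^ 3 - t ^ 2 - t - 1 = 0 := h0
  refine ⟨t, h0', fun s hs => ?_⟩
  have hs' : s ^ 3 - s ^ 2 - s - 1 = 0 := hs
  have h1 : 1 < s := by
    by_contra h
    push Not at h
    nlinarith [mul_nonneg (sub_nonneg.mpr h) (sq_nonneg (s + 1))]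
  have h2 : 1 < t := by
    by_contra h
    push Not at h
    nlinarith [mul_nonneg (sub_nonneg.mpr h) (sq_nonneg (t + 1))]
  have hf : (s - t) * (s ^ 2 + s * t + t ^ 2 - s - t - 1) = 0 := by linear_combination hs' - h0'
  rcases mul_eq_zero.mp hf with h | h
  · linarith
  · nlinarith [mul_pos (sub_pos.mpr h1) (sub_pos.mpr h2)]

/-- The unique real root `λ` of `t³ - t² - t - 1 = 0`. -/
noncomputable def oddLambda : ℝ := Classical.choose existsUnique_tribonacci_root.exists

theorem oddLambda_spec : oddLambda ^ 3 - oddLambda ^ 2 - oddLambda - 1 = 0 :=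
  Classical.choose_spec existsUnique_tribonacci_root.exists

/-! Put `T_s = {1 - x : S(x) ≤ s}`. Reading the first partial quotient and the second sign of `x`,
one sees that for `s ≥ 3` the part of `T_s` in `[0, 1/3]` is the image of `T_{s-2}` under
`y ↦ y / (1 + 2y)`, the part in `[1/3, 1/2)` comes from `T_{s-3}` by `y ↦ 1 / (3 - y)`, and the part
in `[1/2, 1]` is the image of `T_{s-1}` under `y ↦ 1 / (1 + y)`. Hence the cardinalities grow like
`λ ^ s`, and dividing the number of elements of `T_s` below `y` by `λ ^ s` turns the three
subdivision identities into contractions, up to convergent terms. So the normalized counts converge,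
and their limit inherits the identities; iterating the first of them `n` times, alone or composed
with the third, gives the two functional equations. -/

theorem ncard_sep_congr_of_injOn {α β : Type*} {f : α → β} {S : Set α} {T : Set β} {p : α → Prop}
    {q : β → Prop} (hf : Set.InjOn f S) (hST : Set.MapsTo f S T)
    (hsurj : ∀ y ∈ T, q y → y ∈ f '' S) (hpq : ∀ x ∈ S, q (f x) ↔ p x) :
    {y | y ∈ T ∧ q y}.ncard = {x | x ∈ S ∧ p x}.ncard := by
  rw [← (hf.mono fun _ hx => hx.1).ncard_image (s := {x | x ∈ S ∧ p x})]
  congr 1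
  ext y
  constructor
  · rintro ⟨hy, hq⟩
    obtain ⟨x, hx, rfl⟩ := hsurj y hy hq
    exact ⟨x, ⟨hx, (hpq x hx).1 hq⟩, rfl⟩
  · rintro ⟨x, ⟨hx, hp⟩, rfl⟩
    exact ⟨hST hx, (hpq x hx).2 hp⟩

theorem tendsto_zero_of_norm_le_two_term {E : Type*} [SeminormedAddCommGroup E] {d : ℕ → E}
    {α β : ℝ} (hα : 0 ≤ α) (hβ : 0 ≤ β) (hαβ : α + β < 1)
    (hd : ∀ s, ‖d (s + 2)‖ ≤ α * ‖d (s + 1)‖ + β * ‖d s‖) : Tendsto d atTop (𝓝 0) := by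
  set B := ‖d 0‖ + ‖d 1‖
  set r := α + β with hr
  have : 0 ≤ B := by positivity
  have bound_pair : ∀ k, ‖d (2 * k)‖ ≤ B * r ^ k ∧ ‖d (2 * k + 1)‖ ≤ B * r ^ k := by
    intro k
    induction k with
    | zero => simp [B]
    | succ k ih =>
      have : 0 ≤ B * r ^ k := by positivity
      have even : ‖d (2 * k + 2)‖ ≤ B * r ^ (k + 1) := by
        calc ‖d (2 * k + 2)‖ ≤ α * ‖d (2 * k + 1)‖ + β * ‖d (2 * k)‖ := hd _
          _ ≤ α * (B * r ^ k) + β * (B * r ^ k) := by gcongr; exacts [ih.2, ih.1]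
          _ = B * r ^ (k + 1) := by rw [hr]; ring
      refine ⟨even, ?_⟩
      calc ‖d (2 * k + 3)‖ ≤ α * ‖d (2 * k + 2)‖ + β * ‖d (2 * k + 1)‖ := hd _
        _ ≤ α * (B * r ^ (k + 1)) + β * (B * r ^ k) := by gcongr; exact ih.2
        _ ≤ α * (B * r ^ k) + β * (B * r ^ k) := by
          gcongr α * (B * ?_) + _
          exact pow_le_pow_of_le_one (by positivity) hαβ.le k.le_succ
        _ = B * r ^ (k + 1) := by rw [hr]; ring
  have bound : ∀ s, ‖d s‖ ≤ B * r ^ (s / 2) := by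
    intro s
    rcases Nat.even_or_odd' s with ⟨k, rfl | rfl⟩
    · simpa using (bound_pair k).1
    · simpa [Nat.mul_add_div] using (bound_pair k).2
  refine squeeze_zero_norm bound ?_
  simpa using ((tendsto_pow_atTop_nhds_zero_of_lt_one (by positivity) hαβ).comp
    (Nat.tendsto_div_const_atTop two_ne_zero)).const_mul B

theorem tendsto_of_three_term_average {v : ℕ → ℝ} {α β γ : ℝ} (hβ : 0 ≤ β) (hγ : 0 ≤ γ)
    (hγα : γ < α) (hsum : α + β + γ = 1)
    (hv : ∀ s, v (s + 3) = α * v (s + 2) + β * v (s + 1) + γ * v s) :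
    Tendsto v atTop (𝓝 ((v 2 + (β + γ) * v 1 + γ * v 0) / (1 + β + 2 * γ))) := by
  set K := v 2 + (β + γ) * v 1 + γ * v 0
  set c := K / (1 + β + 2 * γ)
  have hc : c * (1 + β + 2 * γ) = K := div_mul_cancel₀ _ (by positivity)
  -- Since `α + β + γ = 1`, the recurrence has a first integral, which lowers its order by one.
  have first_integral : ∀ s, v (s + 2) + (β + γ) * v (s + 1) + γ * v s = K := by
    intro s
    induction s with
    | zero => rfl
    | succ s ih =>
      rw [← ih, hv]
      linear_combination v (s + 2) * hsum
  have deviation : ∀ s, v (s + 2) - c = -((β + γ) * (v (s + 1) - c)) - γ * (v s - c) := by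
    intro s
    linear_combination first_integral s - hc
  rw [← tendsto_sub_nhds_zero_iff]
  refine tendsto_zero_of_norm_le_two_term (add_nonneg hβ hγ) hγ (by linarith) fun s => ?_
  rw [deviation]
  refine (norm_sub_le _ _).trans_eq ?_
  rw [norm_neg, norm_mul, norm_mul, Real.norm_of_nonneg (add_nonneg hβ hγ),
    Real.norm_of_nonneg hγ]

section SelfSimilar

variable {ι 𝕜 E : Type*} [NormedField 𝕜] [SeminormedAddCommGroup E] [NormedSpace 𝕜 E]
  {S : Set ι} {a : ι → ℕ → E} {C r : ℝ}

theorem exists_forall_ge_dist_le_of_forall_eq_add_smul (hr0 : 0 ≤ r) (hr1 : r ≤ 1)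
    (hC : ∀ i ∈ S, ∀ s t, dist (a i s) (a i t) ≤ C)
    (ha : ∀ i ∈ S, ∃ j ∈ S, ∃ (k : ℕ) (σ : 𝕜) (e : ℕ → E), ‖σ‖ ≤ r ∧ CauchySeq e ∧
      ∀ s, a i (s + k) = e s + σ • a j s) (m : ℕ) {i : ι} (hi : i ∈ S) {ε : ℝ} (hε : 0 < ε) :
    ∃ N, ∀ s ≥ N, ∀ t ≥ N, dist (a i s) (a i t) ≤ C * r ^ m + ε := by
  induction m generalizing i ε with
  | zero => exact ⟨0, fun s _ t _ => by linarith [hC i hi s t]⟩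
  | succ m ih =>
    obtain ⟨j, hj, k, σ, e, hσ, he, hij⟩ := ha i hi
    obtain ⟨N₁, hN₁⟩ := ih hj (half_pos hε)
    obtain ⟨N₂, hN₂⟩ := Metric.cauchySeq_iff.1 he (ε / 2) (half_pos hε)
    refine ⟨max N₁ N₂ + k, fun s hs t ht => ?_⟩
    obtain ⟨s, rfl⟩ := Nat.exists_eq_add_of_le' (show k ≤ s by lia)
    obtain ⟨t, rfl⟩ := Nat.exists_eq_add_of_le' (show k ≤ t by lia)
    calc dist (a i (s + k)) (a i (t + k))
        ≤ dist (e s) (e t) + dist (σ • a j s) (σ • a j t) := by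
          rw [hij, hij]
          exact dist_add_add_le _ _ _ _
      _ = dist (e s) (e t) + ‖σ‖ * dist (a j s) (a j t) := by rw [dist_smul₀]
      _ ≤ ε / 2 + r * (C * r ^ m + ε / 2) := by
          gcongr
          exacts [(hN₂ s (by lia) t (by lia)).le, hN₁ s (by lia) t (by lia)]
      _ = C * r ^ (m + 1) + (ε / 2 + r * (ε / 2)) := by ring
      _ ≤ C * r ^ (m + 1) + ε := by
          gcongr
          nlinarith

theorem cauchySeq_of_forall_eq_add_smul (hr : r < 1)
    (hC : ∀ i ∈ S, ∀ s t, dist (a i s) (a i t) ≤ C)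
    (ha : ∀ i ∈ S, ∃ j ∈ S, ∃ (k : ℕ) (σ : 𝕜) (e : ℕ → E), ‖σ‖ ≤ r ∧ CauchySeq e ∧
      ∀ s, a i (s + k) = e s + σ • a j s) {i : ι} (hi : i ∈ S) : CauchySeq (a i) := by
  have hr0 : 0 ≤ r := by
    obtain ⟨-, -, -, σ, -, hσ, -⟩ := ha i hi
    exact (norm_nonneg σ).trans hσ
  have hpow : Tendsto (fun m => C * r ^ m) atTop (𝓝 0) := by
    simpa using (tendsto_pow_atTop_nhds_zero_of_lt_one hr0 hr).const_mul C
  refine Metric.cauchySeq_iff.2 fun ε hε => ?_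
  obtain ⟨m, hm⟩ := (hpow.eventually_lt_const (half_pos hε)).exists
  obtain ⟨N, hN⟩ :=
    exists_forall_ge_dist_le_of_forall_eq_add_smul hr0 hr.le hC ha m hi (half_pos hε)
  exact ⟨N, fun s hs t ht => (hN s hs t ht).trans_lt (by linarith)⟩

end SelfSimilar

theorem exists_eq_of_mem_Icc_zero_one {K : Type*} [Field K] [LinearOrder K]
    [IsStrictOrderedRing K] {y : K} (hy : y ∈ Set.Icc 0 1) :
    ∃ z ∈ Set.Icc (0 : K) 1, y = z / (1 + 2 * z) ∨ y = 1 / (3 - z) ∨ y = 1 / (1 + z) := by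
  rcases le_total y (1 / 3) with hy3 | hy3
  · have hpos : 0 < 1 - 2 * y := by linarith
    refine ⟨y / (1 - 2 * y), ⟨div_nonneg hy.1 hpos.le, (div_le_one hpos).2 (by linarith)⟩,
      Or.inl ?_⟩
    have hden : 1 + 2 * (y / (1 - 2 * y)) = 1 / (1 - 2 * y) := by
      field_simp
      ring
    rw [hden, div_div_div_cancel_right₀ hpos.ne', div_one]
  have hpos : 0 < y := by linarith
  rcases le_total y (1 / 2) with hy2 | hy2
  · refine ⟨3 - 1 / y, ⟨?_, ?_⟩, Or.inr (Or.inl (by simp))⟩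
    · rw [sub_nonneg, div_le_iff₀ hpos]
      linarith
    · rw [sub_le_comm, le_div_iff₀ hpos]
      linarith
  · refine ⟨1 / y - 1, ⟨?_, ?_⟩, Or.inr (Or.inr (by simp))⟩
    · rw [sub_nonneg, le_div_iff₀ hpos]
      linarith [hy.2]
    · rw [sub_le_iff_le_add, div_le_iff₀ hpos]
      linarith

theorem oddTail_cons (e : ℤ) (a : ℕ) (d : List (ℤ × ℕ)) :
    oddTail ((e, a) :: d) = e / (a + oddTail d) := rfl

theorem oddTail_cons_eq_mul (e : ℤ) (a : ℕ) (d : List (ℤ × ℕ)) :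
    oddTail ((e, a) :: d) = e * -oddTail ((-1, a) :: d) := by
  simp only [oddTail_cons]
  push_cast
  ring

theorem neg_oddTail_cons (a : ℕ) (d : List (ℤ × ℕ)) :
    -oddTail ((-1, a) :: d) = 1 / (a + oddTail d) := by
  rw [oddTail_cons]
  push_cast
  ring

theorem neg_oddTail_cons_cons (a : ℕ) (e : ℤ) (b : ℕ) (d : List (ℤ × ℕ)) :
    -oddTail ((-1, a) :: (e, b) :: d) = 1 / (a + e * -oddTail ((-1, b) :: d)) := by
  rw [neg_oddTail_cons, oddTail_cons_eq_mul e]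

theorem quotientSum_cons (e : ℤ) (a : ℕ) (d : List (ℤ × ℕ)) :
    quotientSum ((e, a) :: d) = a + quotientSum d := by
  simp [quotientSum]

namespace IsOddCF

theorem nil : IsOddCF [] := by
  constructor <;> simp

theorem singleton_iff {a : ℕ} : IsOddCF [(-1, a)] ↔ Odd a :=
  ⟨fun h => h.odd (-1, a) (by simp), fun ha => by constructor <;> simp [ha]⟩

theorem eq_nil_or_cons {c : List (ℤ × ℕ)} (h : IsOddCF c) : c = [] ∨ ∃ a d, c = (-1, a) :: d := by
  rcases c with _ | ⟨⟨e, a⟩, d⟩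
  · exact Or.inl rfl
  · obtain rfl : e = -1 := h.first (e, a) rfl
    exact Or.inr ⟨a, d, rfl⟩

theorem cons_cons_iff {e : ℤ} {a b : ℕ} {d : List (ℤ × ℕ)} :
    IsOddCF ((-1, a) :: (e, b) :: d) ↔
      Odd a ∧ (e = 1 ∨ e = -1) ∧ 2 ≤ (a : ℤ) + e ∧ (d = [] → b = 1 → e = 1) ∧
        IsOddCF ((-1, b) :: d) := by
  have hchain : ((e, b) :: d).IsChain (fun p q => 2 ≤ (p.2 : ℤ) + q.1) ↔
      ((-1, b) :: d).IsChain (fun p q => 2 ≤ (p.2 : ℤ) + q.1) := by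
    simp only [List.isChain_cons]
  constructor
  · rintro ⟨sign, odd, -, step, last⟩
    rw [List.isChain_cons_cons, hchain] at step
    simp only [List.forall_mem_cons] at sign odd
    refine ⟨odd.1, sign.2.1, step.1, ?_, ?_, ?_, by simp, step.2, ?_⟩ <;> grind
  · rintro ⟨ha, he, hstep, hlast, sign, odd, -, step, last⟩
    rw [← hchain] at step
    simp only [List.forall_mem_cons] at sign odd
    refine ⟨?_, ?_, by simp, List.isChain_cons_cons.2 ⟨hstep, step⟩, ?_⟩ <;> grind

theorem odd_head {a : ℕ} {d : List (ℤ × ℕ)} (h : IsOddCF ((-1, a) :: d)) : Odd a :=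
  h.odd (-1, a) (by simp)

theorem eq_singleton_one_or_one_lt {a : ℕ} {d : List (ℤ × ℕ)} (h : IsOddCF ((-1, a) :: d)) :
    (a = 1 ∧ d = []) ∨ 1 < a + oddTail d := by
  induction d generalizing a with
  | nil =>
    have := h.odd_head.pos
    rcases eq_or_ne a 1 with rfl | ha
    · exact Or.inl ⟨rfl, rfl⟩
    · have ha2 : 2 ≤ a := by lia
      right
      rw [oddTail, add_zero]
      exact_mod_cast ha2
  | cons p d ih =>
    obtain ⟨e, b⟩ := p
    obtain ⟨ha, he, hstep, -, hd⟩ := cons_cons_iff.1 h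
    have hden : 1 ≤ b + oddTail d := by
      rcases ih hd with ⟨rfl, rfl⟩ | hlt
      · simp [oddTail]
      · exact hlt.le
    have hθ0 : 0 < 1 / (b + oddTail d) := by positivity
    have hθ1 : 1 / (b + oddTail d) ≤ 1 := (div_le_one (by positivity)).2 hden
    right
    rw [oddTail_cons_eq_mul, neg_oddTail_cons]
    rcases he with rfl | rfl
    · have ha1 : (1 : ℚ) ≤ a := by exact_mod_cast ha.pos
      push_cast
      linarith
    · have ha3 : (3 : ℚ) ≤ a := by exact_mod_cast (show 3 ≤ a by lia)
      push_cast
      linarith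

theorem one_le_add_oddTail {a : ℕ} {d : List (ℤ × ℕ)} (h : IsOddCF ((-1, a) :: d)) :
    1 ≤ a + oddTail d := by
  rcases h.eq_singleton_one_or_one_lt with ⟨rfl, rfl⟩ | hlt
  · simp [oddTail]
  · exact hlt.le

theorem neg_oddTail_mem_Icc {c : List (ℤ × ℕ)} (h : IsOddCF c) : -oddTail c ∈ Set.Icc 0 1 := by
  rcases h.eq_nil_or_cons with rfl | ⟨a, d, rfl⟩
  · simp [oddTail]
  · have hden := h.one_le_add_oddTail
    rw [neg_oddTail_cons]
    exact ⟨by positivity, (div_le_one (by positivity)).2 hden⟩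

theorem neg_oddTail_cons_eq_one_iff {a : ℕ} {d : List (ℤ × ℕ)} (h : IsOddCF ((-1, a) :: d)) :
    -oddTail ((-1, a) :: d) = 1 ↔ a = 1 ∧ d = [] := by
  constructor
  · intro heq
    refine h.eq_singleton_one_or_one_lt.resolve_right fun hlt => ?_
    rw [neg_oddTail_cons, div_eq_one_iff_eq (by positivity)] at heq
    exact hlt.ne heq
  · rintro ⟨rfl, rfl⟩
    norm_num [oddTail]

theorem head_add_two {a : ℕ} {d : List (ℤ × ℕ)} (h : IsOddCF ((-1, a) :: d)) :
    IsOddCF ((-1, a + 2) :: d) := by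
  rcases d with _ | ⟨⟨e, b⟩, d⟩
  · simpa [singleton_iff, Nat.odd_add] using h
  · rw [cons_cons_iff] at h ⊢
    refine ⟨by simpa [Nat.odd_add] using h.1, h.2.1, ?_, h.2.2.2⟩
    push_cast
    linarith [h.2.2.1]

theorem neg_oddTail_head_add_two {a : ℕ} {d : List (ℤ × ℕ)} (h : IsOddCF ((-1, a) :: d)) :
    -oddTail ((-1, a + 2) :: d) =
      -oddTail ((-1, a) :: d) / (1 + 2 * -oddTail ((-1, a) :: d)) := by
  have hpos : 0 < a + oddTail d := zero_lt_one.trans_le h.one_le_add_oddTail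
  simp only [neg_oddTail_cons]
  push_cast
  rw [add_right_comm]
  field_simp

theorem head_cases {a : ℕ} {d : List (ℤ × ℕ)} (h : IsOddCF ((-1, a) :: d)) :
    (a = 1 ∧ d = []) ∨
    (∃ b d', a = 1 ∧ d = (1, b) :: d' ∧ IsOddCF ((-1, b) :: d')) ∨
    (∃ b d', a = 3 ∧ d = (-1, b) :: d' ∧ IsOddCF ((-1, b) :: d')) ∨
    ∃ a', a = a' + 2 ∧ IsOddCF ((-1, a') :: d) := by
  obtain ⟨k, hk⟩ := h.odd_head
  rcases d with _ | ⟨⟨e, b⟩, d⟩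
  · rcases k with _ | k
    · exact Or.inl ⟨hk, rfl⟩
    · exact Or.inr (Or.inr (Or.inr ⟨2 * k + 1, by lia, singleton_iff.2 (by simp)⟩))
  · obtain ⟨-, he, hstep, hlast, hd⟩ := cons_cons_iff.1 h
    rcases he with rfl | rfl
    · rcases k with _ | k
      · exact Or.inr (Or.inl ⟨b, d, hk, rfl, hd⟩)
      · refine Or.inr (Or.inr (Or.inr ⟨2 * k + 1, by lia, cons_cons_iff.2 ?_⟩))
        exact ⟨by simp, by simp, by lia, hlast, hd⟩
    · rcases k with _ | _ | k
      · lia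
      · exact Or.inr (Or.inr (Or.inl ⟨b, d, hk, rfl, hd⟩))
      · refine Or.inr (Or.inr (Or.inr ⟨2 * k + 3, by lia, cons_cons_iff.2 ?_⟩))
        exact ⟨by grind, by simp, by lia, hlast, hd⟩

end IsOddCF

/-- The numbers `1 - x` for the `x` whose odd continued fraction has quotient sum at most `s`; in
particular `tailSet (n + 1)` is the reflection of `ℳ_n`. -/
def tailSet (s : ℕ) : Set ℚ :=
  {η | ∃ c, IsOddCF c ∧ -oddTail c = η ∧ quotientSum c ≤ s}

theorem zero_mem_tailSet (s : ℕ) : (0 : ℚ) ∈ tailSet s :=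
  ⟨[], IsOddCF.nil, by simp [oddTail], by simp [quotientSum]⟩

theorem tailSet_subset_Icc (s : ℕ) : tailSet s ⊆ Set.Icc 0 1 := by
  rintro _ ⟨c, hc, rfl, -⟩
  exact hc.neg_oddTail_mem_Icc

theorem cast_mem_Icc_of_mem_tailSet {s : ℕ} {η : ℚ} (hη : η ∈ tailSet s) :
    (η : ℝ) ∈ Set.Icc 0 1 := by
  obtain ⟨h0, h1⟩ := tailSet_subset_Icc s hη
  exact ⟨by exact_mod_cast h0, by exact_mod_cast h1⟩

theorem one_div_one_add_mem_tailSet {s : ℕ} {x : ℚ} (hx : x ∈ tailSet s) :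
    1 / (1 + x) ∈ tailSet (s + 1) := by
  obtain ⟨c, hc, rfl, hs⟩ := hx
  rcases hc.eq_nil_or_cons with rfl | ⟨a, d, rfl⟩
  · exact ⟨[(-1, 1)], IsOddCF.singleton_iff.2 odd_one, by norm_num [oddTail],
      by simp [quotientSum]⟩
  · refine ⟨(-1, 1) :: (1, a) :: d,
      IsOddCF.cons_cons_iff.2 ⟨odd_one, by simp, by simp, by simp, hc⟩, ?_, ?_⟩
    · rw [neg_oddTail_cons_cons]
      simp
    · rw [quotientSum_cons] at hs
      rw [quotientSum_cons, quotientSum_cons]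
      lia

theorem one_mem_tailSet (s : ℕ) : (1 : ℚ) ∈ tailSet (s + 1) := by
  simpa using one_div_one_add_mem_tailSet (zero_mem_tailSet s)

theorem div_one_add_two_mul_mem_tailSet {s : ℕ} {x : ℚ} (hx : x ∈ tailSet s) :
    x / (1 + 2 * x) ∈ tailSet (s + 2) := by
  obtain ⟨c, hc, rfl, hs⟩ := hx
  rcases hc.eq_nil_or_cons with rfl | ⟨a, d, rfl⟩
  · simpa [oddTail] using zero_mem_tailSet (s + 2)
  · refine ⟨(-1, a + 2) :: d, hc.head_add_two, hc.neg_oddTail_head_add_two, ?_⟩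
    rw [quotientSum_cons] at hs ⊢
    lia

theorem one_div_three_sub_mem_tailSet {s : ℕ} {x : ℚ} (hx : x ∈ tailSet s) :
    1 / (3 - x) ∈ tailSet (s + 3) := by
  rcases eq_or_ne x 1 with rfl | hx1
  · convert one_div_one_add_mem_tailSet (one_mem_tailSet (s + 1)) using 2
    norm_num
  obtain ⟨c, hc, rfl, hs⟩ := hx
  rcases hc.eq_nil_or_cons with rfl | ⟨a, d, rfl⟩
  · exact ⟨[(-1, 3)], IsOddCF.singleton_iff.2 (by decide), by norm_num [oddTail],
      by simp [quotientSum]⟩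
  · refine ⟨(-1, 3) :: (-1, a) :: d,
      IsOddCF.cons_cons_iff.2 ⟨by decide, by simp, by simp, ?_, hc⟩, ?_, ?_⟩
    · exact fun hd ha => absurd (hc.neg_oddTail_cons_eq_one_iff.2 ⟨ha, hd⟩) hx1
    · rw [neg_oddTail_cons_cons]
      push_cast
      ring
    · rw [quotientSum_cons] at hs
      rw [quotientSum_cons, quotientSum_cons]
      lia

theorem tailSet_cases {s : ℕ} {η : ℚ} (hη : η ∈ tailSet s) :
    η = 0 ∨ (∃ t, s = t + 1 ∧ ∃ x ∈ tailSet t, 1 / (1 + x) = η) ∨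
      (∃ t, s = t + 2 ∧ ∃ x ∈ tailSet t, x / (1 + 2 * x) = η) ∨
      ∃ t, s = t + 3 ∧ ∃ x ∈ tailSet t, 1 / (3 - x) = η := by
  obtain ⟨c, hc, rfl, hs⟩ := hη
  rcases hc.eq_nil_or_cons with rfl | ⟨a, d, rfl⟩
  · simp [oddTail]
  right
  rw [quotientSum_cons] at hs
  rcases hc.head_cases with ⟨rfl, rfl⟩ | ⟨b, d, rfl, rfl, hd⟩ | ⟨b, d, rfl, rfl, hd⟩ |
    ⟨a, rfl, ha⟩
  · exact Or.inl ⟨s - 1, by lia, 0, zero_mem_tailSet _, by norm_num [oddTail]⟩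
  · rw [quotientSum_cons] at hs
    refine Or.inl ⟨s - 1, by lia, _, ⟨_, hd, rfl, ?_⟩, ?_⟩
    · rw [quotientSum_cons]
      lia
    · rw [neg_oddTail_cons_cons]
      simp
  · rw [quotientSum_cons] at hs
    refine Or.inr (Or.inr ⟨s - 3, by lia, _, ⟨_, hd, rfl, ?_⟩, ?_⟩)
    · rw [quotientSum_cons]
      lia
    · rw [neg_oddTail_cons_cons]
      push_cast
      ring
  · refine Or.inr (Or.inl ⟨s - 2, by lia, _, ⟨_, ha, rfl, ?_⟩, ha.neg_oddTail_head_add_two.symm⟩)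
    rw [quotientSum_cons]
    lia

theorem tailSet_finite (s : ℕ) : (tailSet s).Finite := by
  induction s using Nat.strong_induction_on with
  | _ s ih =>
    have himage : (⋃ t ∈ Set.Iio s, (fun x : ℚ => 1 / (1 + x)) '' tailSet t ∪
        (fun x : ℚ => x / (1 + 2 * x)) '' tailSet t ∪
        (fun x : ℚ => 1 / (3 - x)) '' tailSet t).Finite :=
      (Set.finite_Iio s).biUnion fun t ht =>
        (((ih t ht).image _).union ((ih t ht).image _)).union ((ih t ht).image _)
    refine (himage.insert 0).subset fun η hη => ?_
    rcases tailSet_cases hη with rfl | ⟨t, rfl, x, hx, rfl⟩ | ⟨t, rfl, x, hx, rfl⟩ |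
      ⟨t, rfl, x, hx, rfl⟩
    · exact Set.mem_insert _ _
    all_goals refine Or.inr (Set.mem_biUnion (x := t) (by simp) ?_)
    · exact Or.inl (Or.inl ⟨x, hx, rfl⟩)
    · exact Or.inl (Or.inr ⟨x, hx, rfl⟩)
    · exact Or.inr ⟨x, hx, rfl⟩

theorem tailSet_sep_finite (s : ℕ) (p : ℚ → Prop) : {η | η ∈ tailSet s ∧ p η}.Finite :=
  (tailSet_finite s).subset fun _ hη => hη.1

theorem mem_image_one_div_one_add_of_half_le {s : ℕ} {η : ℚ} (hη : η ∈ tailSet (s + 1))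
    (hη2 : 1 / 2 ≤ η) : η ∈ (fun x : ℚ => 1 / (1 + x)) '' tailSet s := by
  rcases tailSet_cases hη with rfl | ⟨t, ht, x, hx, rfl⟩ | ⟨t, -, x, hx, rfl⟩ |
    ⟨t, ht, x, hx, rfl⟩
  · norm_num at hη2
  · obtain rfl : s = t := by lia
    exact ⟨x, hx, rfl⟩
  · have hx0 := (tailSet_subset_Icc t hx).1
    rw [div_le_div_iff₀ two_pos (by positivity)] at hη2
    linarith
  · have hx1 := (tailSet_subset_Icc t hx).2
    obtain rfl : x = 1 := by
      have := le_of_one_div_le_one_div (by linarith) hη2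
      linarith
    obtain rfl : s = t + 2 := by lia
    exact ⟨1, one_mem_tailSet (t + 1), by norm_num⟩

theorem mem_image_div_one_add_two_mul_of_le_third {s : ℕ} {η : ℚ} (hη : η ∈ tailSet (s + 2))
    (hη3 : η ≤ 1 / 3) : η ∈ (fun x : ℚ => x / (1 + 2 * x)) '' tailSet s := by
  rcases tailSet_cases hη with rfl | ⟨t, -, x, hx, rfl⟩ | ⟨t, ht, x, hx, rfl⟩ |
    ⟨t, ht, x, hx, rfl⟩
  · exact ⟨0, zero_mem_tailSet s, by simp⟩
  · obtain ⟨hx0, hx1⟩ := tailSet_subset_Icc t hx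
    have := le_of_one_div_le_one_div (by positivity) hη3
    linarith
  · obtain rfl : s = t := by lia
    exact ⟨x, hx, rfl⟩
  · obtain ⟨hx0, hx1⟩ := tailSet_subset_Icc t hx
    obtain rfl : x = 0 := by
      have := le_of_one_div_le_one_div (by linarith) hη3
      linarith
    obtain rfl : s = t + 1 := by lia
    exact ⟨1, one_mem_tailSet t, by norm_num⟩

theorem mem_image_one_div_three_sub_of_third_le_of_lt_half {s : ℕ} {η : ℚ}
    (hη : η ∈ tailSet (s + 3)) (hη3 : 1 / 3 ≤ η) (hη2 : η < 1 / 2) :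
    η ∈ (fun x : ℚ => 1 / (3 - x)) '' tailSet s := by
  rcases tailSet_cases hη with rfl | ⟨t, -, x, hx, rfl⟩ | ⟨t, -, x, hx, rfl⟩ |
    ⟨t, ht, x, hx, rfl⟩
  · norm_num at hη3
  · obtain ⟨hx0, hx1⟩ := tailSet_subset_Icc t hx
    have := lt_of_one_div_lt_one_div (by positivity) hη2
    linarith
  · obtain ⟨hx0, hx1⟩ := tailSet_subset_Icc t hx
    obtain rfl : x = 1 := by
      rw [div_le_div_iff₀ three_pos (by positivity)] at hη3
      linarith
    exact ⟨0, zero_mem_tailSet s, by norm_num⟩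
  · obtain rfl : s = t := by lia
    exact ⟨x, hx, rfl⟩

/-- The number of elements of `tailSet s` below `y`, that is, of `ξ ∈ ℳ_{s-1}` with `1 - y < ξ`. -/
noncomputable def tailCount (s : ℕ) (y : ℝ) : ℕ := {η : ℚ | η ∈ tailSet s ∧ (η : ℝ) < y}.ncard

theorem tailCount_mono (s : ℕ) : Monotone (tailCount s) := fun _ _ h =>
  Set.ncard_le_ncard (fun _ hη => ⟨hη.1, hη.2.trans_le h⟩) (tailSet_sep_finite s _)

theorem tailCount_zero (s : ℕ) : tailCount s 0 = 0 := by
  rw [tailCount, Set.ncard_eq_zero (tailSet_sep_finite s _), Set.sep_eq_empty_iff_mem_false]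
  exact fun _ hη => not_lt.2 (cast_mem_Icc_of_mem_tailSet hη).1

theorem tailCount_one_pos (s : ℕ) : 0 < tailCount s 1 :=
  (Set.ncard_pos (tailSet_sep_finite s _)).2 ⟨0, zero_mem_tailSet s, by simp⟩

theorem tailCount_add_ncard_ge (s : ℕ) (y : ℝ) :
    tailCount s y + {η : ℚ | η ∈ tailSet s ∧ y ≤ (η : ℝ)}.ncard = (tailSet s).ncard := by
  rw [← Set.ncard_inter_add_ncard_sdiff_eq_ncard (tailSet s) {η : ℚ | (η : ℝ) < y}
    (tailSet_finite s)]
  congr 2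
  ext η
  simp

theorem tailCount_add_ncard_Ico (s : ℕ) {y z : ℝ} (h : y ≤ z) :
    tailCount s y + {η : ℚ | η ∈ tailSet s ∧ y ≤ (η : ℝ) ∧ (η : ℝ) < z}.ncard =
      tailCount s z := by
  rw [tailCount, tailCount, ← Set.ncard_inter_add_ncard_sdiff_eq_ncard
    {η : ℚ | η ∈ tailSet s ∧ (η : ℝ) < z} {η : ℚ | (η : ℝ) < y} (tailSet_sep_finite s _)]
  congr 2 <;> ext η <;> simp <;> grind

theorem ncard_tailSet_succ (s : ℕ) : (tailSet (s + 1)).ncard = tailCount (s + 1) 1 + 1 := by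
  rw [← tailCount_add_ncard_ge (s + 1) 1]
  congr 1
  refine Set.ncard_eq_one.2 ⟨1, Set.eq_singleton_iff_unique_mem.2 ?_⟩
  refine ⟨⟨one_mem_tailSet s, by simp⟩, ?_⟩
  rintro η ⟨hη, hη1⟩
  exact le_antisymm (tailSet_subset_Icc _ hη).2 (by exact_mod_cast hη1)

theorem ncard_le_mem_Icc (s : ℕ) (y : ℝ) :
    {η : ℚ | η ∈ tailSet s ∧ (η : ℝ) ≤ y}.ncard ∈ Set.Icc (tailCount s y) (tailCount s y + 1) := by
  refine ⟨Set.ncard_le_ncard (fun _ hη => ⟨hη.1, hη.2.le⟩) (tailSet_sep_finite s _), ?_⟩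
  have hsub : {η : ℚ | (η : ℝ) = y}.Subsingleton :=
    fun a ha b hb => Rat.cast_injective (ha.trans hb.symm)
  calc {η : ℚ | η ∈ tailSet s ∧ (η : ℝ) ≤ y}.ncard
      ≤ ({η : ℚ | η ∈ tailSet s ∧ (η : ℝ) < y} ∪ {η : ℚ | (η : ℝ) = y}).ncard :=
        Set.ncard_le_ncard
          (fun η hη => hη.2.lt_or_eq.imp (fun hlt => ⟨hη.1, hlt⟩) fun heq => heq)
          ((tailSet_sep_finite s _).union hsub.finite)
    _ ≤ tailCount s y + 1 :=
        (Set.ncard_union_le _ _).trans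
          (Nat.add_le_add_left ((Set.ncard_le_one hsub.finite).2 fun _ ha _ hb => hsub ha hb) _)

theorem div_one_add_two_mul_lt_iff {K : Type*} [Field K] [LinearOrder K] [IsStrictOrderedRing K]
    {x y : K} (hx : 0 ≤ x) (hy : 0 ≤ y) : x / (1 + 2 * x) < y / (1 + 2 * y) ↔ x < y := by
  rw [div_lt_div_iff₀ (by positivity) (by positivity)]
  constructor <;> intro h <;> linarith

theorem tailCount_div_one_add_two_mul (s : ℕ) {y : ℝ} (hy : y ∈ Set.Icc 0 1) :
    tailCount (s + 2) (y / (1 + 2 * y)) = tailCount s y := by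
  obtain ⟨hy0, hy1⟩ := hy
  refine ncard_sep_congr_of_injOn (f := fun x : ℚ => x / (1 + 2 * x)) ?_
    (fun _ => div_one_add_two_mul_mem_tailSet) ?_ ?_
  · intro a ha b hb hab
    have ha0 := (tailSet_subset_Icc s ha).1
    have hb0 := (tailSet_subset_Icc s hb).1
    rw [div_eq_div_iff (by positivity) (by positivity)] at hab
    linarith
  · intro η hη hlt
    have hle : y / (1 + 2 * y) ≤ (1 / 3 : ℚ) := by
      push_cast
      rw [div_le_div_iff₀ (by positivity) three_pos]
      linarith
    exact mem_image_div_one_add_two_mul_of_le_third hη (Rat.cast_le.1 (hlt.le.trans hle))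
  · intro x hx
    push_cast
    exact div_one_add_two_mul_lt_iff (cast_mem_Icc_of_mem_tailSet hx).1 hy0

theorem tailCount_one_div_one_add (s : ℕ) {y : ℝ} (hy : y ∈ Set.Icc 0 1) :
    tailCount (s + 1) (1 / (1 + y)) + {η : ℚ | η ∈ tailSet s ∧ (η : ℝ) ≤ y}.ncard =
      (tailSet (s + 1)).ncard := by
  obtain ⟨hy0, hy1⟩ := hy
  rw [← tailCount_add_ncard_ge (s + 1) (1 / (1 + y))]
  congr 1
  symm
  refine ncard_sep_congr_of_injOn (f := fun x : ℚ => 1 / (1 + x))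
    (fun a _ b _ hab => by simpa using hab) (fun _ => one_div_one_add_mem_tailSet) ?_ ?_
  · intro η hη hle
    have hhalf : (1 / 2 : ℚ) ≤ 1 / (1 + y) := by
      push_cast
      exact one_div_le_one_div_of_le (by positivity) (by linarith)
    exact mem_image_one_div_one_add_of_half_le hη (Rat.cast_le.1 (hhalf.trans hle))
  · intro x hx
    have hx0 := (cast_mem_Icc_of_mem_tailSet hx).1
    push_cast
    rw [one_div_le_one_div (by positivity) (by positivity), add_le_add_iff_left]

theorem tailCount_one_div_three_sub (s : ℕ) {y : ℝ} (hy : y ∈ Set.Icc 0 1) :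
    tailCount (s + 3) (1 / (3 - y)) = tailCount (s + 1) 1 + tailCount s y := by
  obtain ⟨hy0, hy1⟩ := hy
  have below_third : tailCount (s + 3) (1 / 3) = tailCount (s + 1) 1 := by
    rw [← tailCount_div_one_add_two_mul (s + 1) (Set.right_mem_Icc.2 zero_le_one)]
    norm_num
  have third_le : 1 / 3 ≤ 1 / (3 - y) := one_div_le_one_div_of_le (by linarith) (by linarith)
  rw [← tailCount_add_ncard_Ico (s + 3) third_le, below_third]
  congr 1
  refine ncard_sep_congr_of_injOn (f := fun x : ℚ => 1 / (3 - x))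
    (fun a _ b _ hab => by simpa using hab) (fun _ => one_div_three_sub_mem_tailSet) ?_ ?_
  · rintro η hη ⟨hle, hlt⟩
    have hthird : ((1 / 3 : ℚ) : ℝ) ≤ η := by
      push_cast
      exact hle
    have hhalf : 1 / (3 - y) ≤ (1 / 2 : ℚ) := by
      push_cast
      exact one_div_le_one_div_of_le two_pos (by linarith)
    exact mem_image_one_div_three_sub_of_third_le_of_lt_half hη (Rat.cast_le.1 hthird)
      (Rat.cast_lt.1 (hlt.trans_le hhalf))
  · intro x hx
    obtain ⟨hx0, hx1⟩ := cast_mem_Icc_of_mem_tailSet hx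
    push_cast
    rw [one_div_le_one_div (by linarith) (by linarith),
      one_div_lt_one_div (by linarith) (by linarith), sub_lt_sub_iff_left]
    exact and_iff_right (by linarith)

theorem tailCount_one_add_three (s : ℕ) :
    tailCount (s + 3) 1 = tailCount (s + 2) 1 + tailCount (s + 1) 1 + tailCount s 1 := by
  have below_half : tailCount (s + 3) (1 / 2) = tailCount (s + 1) 1 + tailCount s 1 := by
    rw [← tailCount_one_div_three_sub s (Set.right_mem_Icc.2 zero_le_one)]
    norm_num
  have above_half := tailCount_one_div_one_add (s + 2) (Set.right_mem_Icc.2 zero_le_one)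
  have all_le_one : {η : ℚ | η ∈ tailSet (s + 2) ∧ (η : ℝ) ≤ 1} = tailSet (s + 2) :=
    Set.sep_eq_self_iff_mem_true.2 fun _ hη => (cast_mem_Icc_of_mem_tailSet hη).2
  rw [all_le_one, one_add_one_eq_two, below_half, ncard_tailSet_succ, ncard_tailSet_succ]
    at above_half
  lia

theorem one_lt_oddLambda : 1 < oddLambda := by
  by_contra! h
  nlinarith [oddLambda_spec, mul_nonneg (sub_nonneg.2 h) (sq_nonneg (oddLambda + 1))]

theorem oddLambda_pos : 0 < oddLambda := zero_lt_one.trans one_lt_oddLambda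

theorem inv_oddLambda_lt_one : oddLambda⁻¹ < 1 := inv_lt_one_of_one_lt₀ one_lt_oddLambda

theorem inv_oddLambda_sum : oddLambda⁻¹ + oddLambda⁻¹ ^ 2 + oddLambda⁻¹ ^ 3 = 1 := by
  have := oddLambda_pos
  field_simp
  linarith [oddLambda_spec]

theorem inv_oddLambda_pow_nonneg (s : ℕ) : 0 ≤ oddLambda⁻¹ ^ s :=
  pow_nonneg (inv_nonneg.2 oddLambda_pos.le) s

theorem tendsto_inv_oddLambda_pow : Tendsto (fun s : ℕ => oddLambda⁻¹ ^ s) atTop (𝓝 0) :=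
  tendsto_pow_atTop_nhds_zero_of_lt_one (inv_nonneg.2 oddLambda_pos.le) inv_oddLambda_lt_one

/-- The normalized counting function `tailCount s y / λ ^ s`; the normalization turns the
subdivision identities of `tailCount` into contractions with ratio at most `1 / λ`. -/
noncomputable def scaledCount (s : ℕ) (y : ℝ) : ℝ := oddLambda⁻¹ ^ s * tailCount s y

theorem scaledCount_nonneg (s : ℕ) (y : ℝ) : 0 ≤ scaledCount s y :=
  mul_nonneg (inv_oddLambda_pow_nonneg s) (Nat.cast_nonneg _)

theorem scaledCount_mono (s : ℕ) : Monotone (scaledCount s) := fun _ _ h =>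
  mul_le_mul_of_nonneg_left (Nat.cast_le.2 (tailCount_mono s h)) (inv_oddLambda_pow_nonneg s)

theorem scaledCount_zero (s : ℕ) : scaledCount s 0 = 0 := by
  rw [scaledCount, tailCount_zero, Nat.cast_zero, mul_zero]

theorem scaledCount_one_pos (s : ℕ) : 0 < scaledCount s 1 :=
  mul_pos (pow_pos (inv_pos.2 oddLambda_pos) s) (Nat.cast_pos.2 (tailCount_one_pos s))

theorem scaledCount_one_add_three (s : ℕ) :
    scaledCount (s + 3) 1 = oddLambda⁻¹ * scaledCount (s + 2) 1 +
      oddLambda⁻¹ ^ 2 * scaledCount (s + 1) 1 + oddLambda⁻¹ ^ 3 * scaledCount s 1 := by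
  simp only [scaledCount, tailCount_one_add_three]
  push_cast
  ring

theorem scaledCount_div_one_add_two_mul (s : ℕ) {y : ℝ} (hy : y ∈ Set.Icc 0 1) :
    scaledCount (s + 2) (y / (1 + 2 * y)) = oddLambda⁻¹ ^ 2 * scaledCount s y := by
  rw [scaledCount, scaledCount, tailCount_div_one_add_two_mul s hy]
  ring

theorem scaledCount_one_div_three_sub (s : ℕ) {y : ℝ} (hy : y ∈ Set.Icc 0 1) :
    scaledCount (s + 3) (1 / (3 - y)) =
      oddLambda⁻¹ ^ 2 * scaledCount (s + 1) 1 + oddLambda⁻¹ ^ 3 * scaledCount s y := by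
  simp only [scaledCount, tailCount_one_div_three_sub s hy]
  push_cast
  ring

theorem exists_pos_tendsto_scaledCount_one :
    ∃ c, 0 < c ∧ Tendsto (fun s => scaledCount s 1) atTop (𝓝 c) := by
  have hx := inv_pos.2 oddLambda_pos
  have h0 := scaledCount_one_pos 0
  have h1 := scaledCount_one_pos 1
  have h2 := scaledCount_one_pos 2
  exact ⟨_, by positivity, tendsto_of_three_term_average (by positivity) (by positivity)
    (pow_lt_self_of_lt_one₀ hx inv_oddLambda_lt_one (by simp)) inv_oddLambda_sum
    scaledCount_one_add_three⟩

theorem tendsto_scaledCount_one_div_one_add_add {y c : ℝ} (hy : y ∈ Set.Icc 0 1)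
    (hc : Tendsto (fun s => scaledCount s 1) atTop (𝓝 c)) :
    Tendsto (fun s => scaledCount (s + 1) (1 / (1 + y)) + oddLambda⁻¹ * scaledCount s y)
      atTop (𝓝 c) := by
  have hc' := (tendsto_add_atTop_iff_nat 1).2 hc
  have hc'' := hc'.add ((tendsto_add_atTop_iff_nat 1).2 tendsto_inv_oddLambda_pow)
  rw [add_zero] at hc''
  have counts (s : ℕ) : tailCount (s + 1) (1 / (1 + y)) + tailCount s y ∈
      Set.Icc (tailCount (s + 1) 1) (tailCount (s + 1) 1 + 1) := by
    have hsplit := tailCount_one_div_one_add s hy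
    obtain ⟨hlower, hupper⟩ := ncard_le_mem_Icc s y
    rw [ncard_tailSet_succ] at hsplit
    exact ⟨by lia, by lia⟩
  have scaled (s : ℕ) : scaledCount (s + 1) (1 / (1 + y)) + oddLambda⁻¹ * scaledCount s y =
      oddLambda⁻¹ ^ (s + 1) * ((tailCount (s + 1) (1 / (1 + y)) + tailCount s y : ℕ) : ℝ) := by
    simp only [scaledCount]
    push_cast
    ring
  refine tendsto_of_tendsto_of_tendsto_of_le_of_le hc' hc'' (fun s => ?_) (fun s => ?_)
  · rw [scaled]
    exact mul_le_mul_of_nonneg_left (Nat.cast_le.2 (counts s).1) (inv_oddLambda_pow_nonneg _)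
  · rw [scaled, scaledCount, ← mul_add_one, ← Nat.cast_add_one]
    exact mul_le_mul_of_nonneg_left (Nat.cast_le.2 (counts s).2) (inv_oddLambda_pow_nonneg _)

theorem cauchySeq_scaledCount {y : ℝ} (hy : y ∈ Set.Icc 0 1) :
    CauchySeq fun s => scaledCount s y := by
  obtain ⟨c, -, hc⟩ := exists_pos_tendsto_scaledCount_one
  obtain ⟨C, hC⟩ := hc.bddAbove_range
  have bound : ∀ z ∈ Set.Icc (0 : ℝ) 1, ∀ s, scaledCount s z ∈ Set.Icc 0 C := fun z hz s =>
    ⟨scaledCount_nonneg s z, (scaledCount_mono s hz.2).trans (hC ⟨s, rfl⟩)⟩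
  have hpow {k : ℕ} (hk : k ≠ 0) : ‖oddLambda⁻¹ ^ k‖ ≤ oddLambda⁻¹ := by
    rw [Real.norm_of_nonneg (inv_oddLambda_pow_nonneg k)]
    exact pow_le_of_le_one (inv_nonneg.2 oddLambda_pos.le) inv_oddLambda_lt_one.le hk
  refine cauchySeq_of_forall_eq_add_smul (a := fun z s => scaledCount s z) (𝕜 := ℝ)
    inv_oddLambda_lt_one (fun z hz s t => Real.dist_le_of_mem_Icc (bound z hz s) (bound z hz t))
    (fun w hw => ?_) hy
  obtain ⟨z, hz, rfl | rfl | rfl⟩ := exists_eq_of_mem_Icc_zero_one hw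
  · exact ⟨z, hz, 2, oddLambda⁻¹ ^ 2, fun _ => 0, hpow two_ne_zero, cauchySeq_const 0,
      fun s => by simp [scaledCount_div_one_add_two_mul s hz]⟩
  · exact ⟨z, hz, 3, oddLambda⁻¹ ^ 3, fun s => oddLambda⁻¹ ^ 2 * scaledCount (s + 1) 1,
      hpow three_ne_zero, (((tendsto_add_atTop_iff_nat 1).2 hc).const_mul _).cauchySeq,
      fun s => scaledCount_one_div_three_sub s hz⟩
  · exact ⟨z, hz, 1, -oddLambda⁻¹,
      fun s => scaledCount (s + 1) (1 / (1 + z)) + oddLambda⁻¹ * scaledCount s z,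
      by simpa using hpow one_ne_zero,
      (tendsto_scaledCount_one_div_one_add_add hz hc).cauchySeq, fun s => by simp⟩

/-- The limit of the normalized counting functions: up to the factor `tailLimit 1` it is the
reflected distribution function `1 - F(1 - y)`. -/
noncomputable def tailLimit (y : ℝ) : ℝ := limUnder atTop fun s => scaledCount s y

theorem tendsto_scaledCount {y : ℝ} (hy : y ∈ Set.Icc 0 1) :
    Tendsto (fun s => scaledCount s y) atTop (𝓝 (tailLimit y)) :=
  (cauchySeq_scaledCount hy).tendsto_limUnder

theorem tendsto_scaledCount_one : Tendsto (fun s => scaledCount s 1) atTop (𝓝 (tailLimit 1)) :=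
  tendsto_scaledCount (Set.right_mem_Icc.2 zero_le_one)

theorem tailLimit_zero : tailLimit 0 = 0 := by
  simp only [tailLimit, scaledCount_zero]
  exact tendsto_const_nhds.limUnder_eq

theorem tailLimit_one_pos : 0 < tailLimit 1 := by
  obtain ⟨c, hc0, hc⟩ := exists_pos_tendsto_scaledCount_one
  exact hc0.trans_eq (tendsto_nhds_unique hc tendsto_scaledCount_one)

theorem div_one_add_two_mul_mem_Icc {y : ℝ} (hy : y ∈ Set.Icc 0 1) (m : ℕ) :
    y / (1 + 2 * m * y) ∈ Set.Icc 0 1 := by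
  obtain ⟨hy0, hy1⟩ := hy
  have : 0 ≤ 2 * m * y := by positivity
  exact ⟨by positivity, (div_le_one (by positivity)).2 (by linarith)⟩

theorem one_div_two_mul_add_one_add_mem_Icc {x : ℝ} (hx : x ∈ Set.Icc 0 1) (m : ℕ) :
    1 / (2 * m + 1 + x) ∈ Set.Icc 0 1 := by
  obtain ⟨hx0, -⟩ := hx
  have : (0 : ℝ) ≤ m := m.cast_nonneg
  exact ⟨by positivity, (div_le_one (by positivity)).2 (by linarith)⟩

theorem tailLimit_one_div_one_add {y : ℝ} (hy : y ∈ Set.Icc 0 1) :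
    tailLimit (1 / (1 + y)) = tailLimit 1 - tailLimit y / oddLambda := by
  have hmem : 1 / (1 + y) ∈ Set.Icc (0 : ℝ) 1 := by
    simpa using one_div_two_mul_add_one_add_mem_Icc hy 0
  have hsum := ((tendsto_add_atTop_iff_nat 1).2 (tendsto_scaledCount hmem)).add
    ((tendsto_scaledCount hy).const_mul oddLambda⁻¹)
  have := tendsto_nhds_unique hsum
    (tendsto_scaledCount_one_div_one_add_add hy tendsto_scaledCount_one)
  rw [← this]
  ring

theorem tailLimit_div_one_add_two_mul {y : ℝ} (hy : y ∈ Set.Icc 0 1) :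
    tailLimit (y / (1 + 2 * y)) = tailLimit y / oddLambda ^ 2 := by
  have hmem := by simpa using div_one_add_two_mul_mem_Icc hy 1
  have hlim := (tendsto_add_atTop_iff_nat 2).2 (tendsto_scaledCount hmem)
  simp only [scaledCount_div_one_add_two_mul _ hy] at hlim
  rw [tendsto_nhds_unique hlim ((tendsto_scaledCount hy).const_mul _)]
  ring

theorem tailLimit_div_one_add_two_mul_natCast {y : ℝ} (hy : y ∈ Set.Icc 0 1) (m : ℕ) :
    tailLimit (y / (1 + 2 * m * y)) = tailLimit y / oddLambda ^ (2 * m) := by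
  induction m with
  | zero => simp
  | succ m ih =>
    have hy0 := hy.1
    have hiterate : y / (1 + 2 * (m + 1 : ℕ) * y) =
        y / (1 + 2 * m * y) / (1 + 2 * (y / (1 + 2 * m * y))) := by
      push_cast
      field_simp
      ring
    rw [hiterate, tailLimit_div_one_add_two_mul (div_one_add_two_mul_mem_Icc hy m), ih, div_div,
      ← pow_add, mul_add_one]

theorem tailLimit_one_div_two_mul_add_one_add {x : ℝ} (hx : x ∈ Set.Icc 0 1) (m : ℕ) :
    tailLimit (1 / (2 * m + 1 + x)) =
      (tailLimit 1 - tailLimit x / oddLambda) / oddLambda ^ (2 * m) := by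
  have hx0 := hx.1
  have hmem : 1 / (1 + x) ∈ Set.Icc (0 : ℝ) 1 := by
    simpa using one_div_two_mul_add_one_add_mem_Icc hx 0
  have hiterate : 1 / (2 * m + 1 + x) = 1 / (1 + x) / (1 + 2 * m * (1 / (1 + x))) := by
    field_simp
    ring
  rw [hiterate, tailLimit_div_one_add_two_mul_natCast hmem, tailLimit_one_div_one_add hx]

theorem mem_oddM_iff {n : ℕ} {ξ : ℚ} : ξ ∈ oddM n ↔ 1 - ξ ∈ tailSet (n + 1) := by
  constructor
  · rintro ⟨-, c, ⟨hc, rfl⟩, hs⟩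
    exact ⟨c, hc, by ring, hs⟩
  · intro hξ
    obtain ⟨h0, h1⟩ := tailSet_subset_Icc _ hξ
    obtain ⟨c, hc, hval, hs⟩ := hξ
    exact ⟨⟨by linarith, by linarith⟩, c, ⟨hc, by linarith⟩, hs⟩

theorem ncard_oddM_sep (n : ℕ) (p : ℚ → Prop) :
    {ξ | ξ ∈ oddM n ∧ p ξ}.ncard = {η | η ∈ tailSet (n + 1) ∧ p (1 - η)}.ncard :=
  ncard_sep_congr_of_injOn (sub_right_injective.injOn)
    (fun η hη => mem_oddM_iff.2 (by rwa [sub_sub_cancel]))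
    (fun ξ hξ _ => ⟨1 - ξ, mem_oddM_iff.1 hξ, sub_sub_cancel 1 ξ⟩) (fun _ _ => Iff.rfl)

theorem oddFn_eq (n : ℕ) (x : ℝ) :
    oddFn n x = 1 - tailCount (n + 1) (1 - x) / (tailCount (n + 1) 1 + 1) := by
  have htotal : (oddM n).ncard = tailCount (n + 1) 1 + 1 := by
    simpa [ncard_tailSet_succ] using ncard_oddM_sep n fun _ => True
  have hcount : {ξ : ℚ | ξ ∈ oddM n ∧ (ξ : ℝ) ≤ x}.ncard + tailCount (n + 1) (1 - x) =
      tailCount (n + 1) 1 + 1 := by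
    rw [ncard_oddM_sep n fun ξ => (ξ : ℝ) ≤ x, ← ncard_tailSet_succ,
      ← tailCount_add_ncard_ge (n + 1) (1 - x), add_comm]
    simp only [Rat.cast_sub, Rat.cast_one, sub_le_comm]
  rw [oddFn, htotal, eq_sub_iff_add_eq]
  push_cast
  rw [← add_div, div_eq_one_iff_eq (by positivity)]
  exact_mod_cast hcount

theorem tendsto_oddFn {x : ℝ} (hx : x ∈ Set.Icc 0 1) :
    Tendsto (fun n => oddFn n x) atTop (𝓝 (1 - tailLimit (1 - x) / tailLimit 1)) := by
  have hmem : 1 - x ∈ Set.Icc (0 : ℝ) 1 := Set.Icc.mem_iff_one_sub_mem.1 hx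
  have htotal : Tendsto (fun s => scaledCount s 1 + oddLambda⁻¹ ^ s) atTop (𝓝 (tailLimit 1)) := by
    simpa using tendsto_scaledCount_one.add tendsto_inv_oddLambda_pow
  have hquot := (tendsto_add_atTop_iff_nat 1).2
    ((tendsto_scaledCount hmem).div htotal tailLimit_one_pos.ne')
  refine (hquot.const_sub 1).congr fun n => ?_
  have hpow : oddLambda⁻¹ ^ (n + 1) ≠ 0 := pow_ne_zero _ (inv_ne_zero oddLambda_pos.ne')
  rw [oddFn_eq, Pi.div_apply, scaledCount, scaledCount, ← mul_add_one, mul_div_mul_left _ _ hpow]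

theorem one_sub_oddF_one_sub {y : ℝ} (hy : y ∈ Set.Icc 0 1) :
    1 - oddF (1 - y) = tailLimit y / tailLimit 1 := by
  have hmem : 1 - y ∈ Set.Icc (0 : ℝ) 1 := Set.Icc.mem_iff_one_sub_mem.1 hy
  rw [oddF, (tendsto_oddFn hmem).limUnder_eq, sub_sub_cancel, sub_sub_cancel]

theorem one_sub_oddF_one_sub_one_div_two_mul_add_one_add {x : ℝ} (hx : x ∈ Set.Icc 0 1) (m : ℕ) :
    1 - oddF (1 - 1 / (2 * m + 1 + x)) =
      1 / oddLambda ^ (2 * m) - (1 - oddF (1 - x)) / oddLambda ^ (2 * m + 1) := by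
  have hone : tailLimit 1 ≠ 0 := tailLimit_one_pos.ne'
  have hlambda : oddLambda ≠ 0 := oddLambda_pos.ne'
  rw [one_sub_oddF_one_sub (one_div_two_mul_add_one_add_mem_Icc hx m),
    tailLimit_one_div_two_mul_add_one_add hx, one_sub_oddF_one_sub hx]
  field_simp
  ring

theorem one_sub_oddF_one_sub_div_one_add_two_mul {x : ℝ} (hx : x ∈ Set.Icc 0 1) (m : ℕ) :
    1 - oddF (1 - x / (1 + 2 * m * x)) = (1 - oddF (1 - x)) / oddLambda ^ (2 * m) := by
  rw [one_sub_oddF_one_sub (div_one_add_two_mul_mem_Icc hx m),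
    tailLimit_div_one_add_two_mul_natCast hx, one_sub_oddF_one_sub hx, div_right_comm]

/-- The limit distribution function `F` exists on `[0, 1]` and satisfies both functional equations.
In the second one `1 / (2n + 1/x)` is read as `0` for `x = 0`; that case is the last conjunct. -/
theorem proposition1 :
    (∀ x ∈ Set.Icc (0 : ℝ) 1, Tendsto (fun n : ℕ => oddFn n x) atTop (𝓝 (oddF x))) ∧
    (∀ n : ℕ, 1 ≤ n → ∀ x ∈ Set.Icc (0 : ℝ) 1,
      (1 - oddF (1 - x)) / oddLambda ^ (2 * n - 1) =
        1 / oddLambda ^ (2 * n - 2) - 1 + oddF (1 - 1 / (2 * (n : ℝ) - 1 + x))) ∧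
    (∀ n : ℕ, 1 ≤ n → ∀ x ∈ Set.Ioc (0 : ℝ) 1,
      (1 - oddF (1 - x)) / oddLambda ^ (2 * n) =
        1 - oddF (1 - 1 / (2 * (n : ℝ) + 1 / x))) ∧
    (∀ n : ℕ, 1 ≤ n →
      (1 - oddF (1 - 0)) / oddLambda ^ (2 * n) = 1 - oddF (1 - 0)) := by
  refine ⟨fun x hx => tendsto_nhds_limUnder ⟨_, tendsto_oddFn hx⟩, fun n hn x hx => ?_,
    fun n _ x hx => ?_, fun n _ => ?_⟩
  · obtain ⟨m, rfl⟩ := Nat.exists_eq_add_of_le' hn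
    have harg : 2 * ((m + 1 : ℕ) : ℝ) - 1 + x = 2 * m + 1 + x := by
      push_cast
      ring
    have hF := one_sub_oddF_one_sub_one_div_two_mul_add_one_add hx m
    rw [harg, show 2 * (m + 1) - 1 = 2 * m + 1 by lia, show 2 * (m + 1) - 2 = 2 * m by lia]
    linarith
  · have harg : 1 / (2 * (n : ℝ) + 1 / x) = x / (1 + 2 * n * x) := by
      have hx0 := hx.1
      field_simp
      ring
    rw [harg, one_sub_oddF_one_sub_div_one_add_two_mul (Set.Ioc_subset_Icc_self hx)]
  · rw [one_sub_oddF_one_sub (Set.left_mem_Icc.2 zero_le_one), tailLimit_zero, zero_div, zero_div]
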